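/- A field extension $F\subseteq L$ is a radical extension if $L=F[\alpha]$ for some $\alpha\in L$ with $\alpha^n\in F$ for some positive integer $n$. It is a repeated radical extension if there are intermediate fields $F=L_0\subseteq L_1\subseteq\cdots\subseteq L_r=L$ such that each $L_i$ is a radical extension of $L_{i-1}$ ($0<i\le r$). A polynomial over a field $F$ of characteristic zero is solvable (by radicals) if its splitting field over $F$ is contained in some repeated radical extension of $F$. A Fermat prime is a prime number of the form $2^{2^k}+1$ with $k\ge 0$ an integer. Theorem. Let $Q$ be a subfield of $\mathbb{R}$ and let $f\in Q[X]$ be irreducible over $Q$. (a) Suppose that $f$ is solvable, that $\deg f=p$ is a Fermat prime, and that $f$ does not split into linear factors over $\mathbb{R}$. Then $f$ has a root that lies in a field $L$ with $Q\subseteq L\subseteq\mathbb{R}$ such that $L$ is a repeated radical extension of $Q$. (b) Suppose that $\deg f=3$ and that $f$ has exactly one real root $\alpha$. Then $\alpha$ lies in a field $L$ with $Q\subseteq L\subseteq\mathbb{R}$ such that $L$ is a repeated radical extension of $Q$. -/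

import Mathlib

open Polynomial

universe u v

/-- Inside a field `E` containing `F`, the extension `K ⊆ M` of intermediate fields is a *radical
extension*: `M = K(α)` for some `α` with `α ^ n ∈ K` for some positive integer `n`. -/
def IsRadicalExtension {F : Type u} {E : Type v} [Field F] [Field E] [Algebra F E]
    (K M : IntermediateField F E) : Prop :=
  ∃ (α : E) (n : ℕ), 0 < n ∧ α ^ n ∈ K ∧
    M = (IntermediateField.adjoin K {α}).restrictScalars F

/-- `F ⊆ L` is a *repeated radical extension*: there is a finite chain
`F = L₀ ⊆ L₁ ⊆ ⋯ ⊆ Lᵣ = L` of intermediate fields (`r = 0` is allowed) such that each `Lᵢ` is a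
radical extension of `Lᵢ₋₁`. -/
def IsRepeatedRadicalExtension {F : Type u} {E : Type v} [Field F] [Field E] [Algebra F E]
    (L : IntermediateField F E) : Prop :=
  Relation.ReflTransGen (IsRadicalExtension (F := F) (E := E)) ⊥ L

/-- `f` is *solvable by radicals* over `F`: a splitting field of `f` over `F` (taken inside an
algebraic closure of `F`) is contained in some repeated radical extension of `F`. -/
def IsSolvableByRadicals {F : Type u} [Field F] (f : F[X]) : Prop :=
  ∃ R : IntermediateField F (AlgebraicClosure F), IsRepeatedRadicalExtension R ∧
    IntermediateField.adjoin F (f.rootSet (AlgebraicClosure F)) ≤ R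

/-- A *Fermat prime* is a prime of the form `2 ^ (2 ^ k) + 1`. -/
def IsFermatPrime (p : ℕ) : Prop :=
  p.Prime ∧ ∃ k : ℕ, p = 2 ^ (2 ^ k) + 1

/-! ### Radical towers and quadratic steps -/

section RadicalExtensions

variable {F : Type*} {E E' : Type*} [Field F] [Field E] [Algebra F E] [Field E'] [Algebra F E']

/-! A solvable transitive group of prime degree `p` acts on the roots by affine maps `i ↦ a * i + b`
of `ZMod p`. Complex conjugation fixes some root `x 0`, as `p` is odd, and moves another, so it acts
as `i ↦ -i`. It also inverts `p`-th roots of unity, hence fixes every Lagrange resolvent `∑ i, ψ (j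
* i) * x i`: the resolvents are real although `ψ` is not. Galois automorphisms permute the `p`-th
powers of the resolvents through multiplication of `j` by units of `ZMod p`. For a Fermat prime the
exponent `p - 1` is a power of 2, so these powers generate a Galois extension with 2-group, a tower
of square roots. Adjoining the resolvents themselves gives a real radical tower, and their sum is `p
* x 0`. The cubic case is `p = 3`, where solvability is automatic. -/

theorem isRadicalExtension_iff_sup {K M : IntermediateField F E} :
    IsRadicalExtension K M ↔ ∃ (α : E) (n : ℕ), 0 < n ∧ α ^ n ∈ K ∧
      M = K ⊔ IntermediateField.adjoin F {α} := by
  simp only [IsRadicalExtension, IntermediateField.restrictScalars_adjoin_eq_sup]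

theorem IsRadicalExtension.le {K M : IntermediateField F E} (h : IsRadicalExtension K M) :
    K ≤ M := by
  obtain ⟨α, n, -, -, rfl⟩ := isRadicalExtension_iff_sup.1 h
  exact le_sup_left

theorem IsRadicalExtension.map {K M : IntermediateField F E} (h : IsRadicalExtension K M)
    (φ : E →ₐ[F] E') : IsRadicalExtension (K.map φ) (M.map φ) := by
  obtain ⟨α, n, hn, hα, rfl⟩ := isRadicalExtension_iff_sup.1 h
  refine isRadicalExtension_iff_sup.2 ⟨φ α, n, hn, ⟨α ^ n, hα, map_pow φ α n⟩, ?_⟩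
  rw [IntermediateField.map_sup, IntermediateField.adjoin_map, Set.image_singleton]

theorem IsRepeatedRadicalExtension.map {L : IntermediateField F E}
    (h : IsRepeatedRadicalExtension L) (φ : E →ₐ[F] E') :
    IsRepeatedRadicalExtension (L.map φ) := by
  induction h with
  | refl =>
    rw [IntermediateField.map_bot]
    exact Relation.ReflTransGen.refl
  | tail _ h ih => exact ih.tail (h.map φ)

/-- Brings a tower of real subfields of `ℂ` back to `ℝ`; `hL` lets each radical generator be lifted.
-/
theorem IsRepeatedRadicalExtension.comap {L : IntermediateField F E'}
    (h : IsRepeatedRadicalExtension L) (φ : E →ₐ[F] E') (hL : L ≤ φ.fieldRange) :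
    IsRepeatedRadicalExtension (L.comap φ) := by
  induction h with
  | refl =>
    have : (⊥ : IntermediateField F E').comap φ = ⊥ := by
      rw [← IntermediateField.map_bot φ, IntermediateField.comap_map]
    rw [this]
    exact Relation.ReflTransGen.refl
  | @tail K M _ hKM ih =>
    have hK := hKM.le.trans hL
    refine (ih hK).tail ?_
    obtain ⟨α, n, hn, hα, hM⟩ := isRadicalExtension_iff_sup.1 hKM
    obtain ⟨a, rfl⟩ : α ∈ φ.fieldRange := hL <| by
      rw [hM]
      exact (le_sup_right : _ ≤ K ⊔ _) (IntermediateField.mem_adjoin_simple_self F α)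
    refine isRadicalExtension_iff_sup.2 ⟨a, n, hn, ?_, ?_⟩
    · change φ (a ^ n) ∈ K
      rwa [map_pow]
    · have hmap : (K.comap φ).map φ = K := by
        ext x
        refine ⟨?_, fun hx ↦ ?_⟩
        · rintro ⟨y, hy, rfl⟩
          exact hy
        · obtain ⟨y, rfl⟩ := hK hx
          exact ⟨y, hx, rfl⟩
      rw [hM, ← IntermediateField.comap_map (f := φ) (K.comap φ ⊔ _), IntermediateField.map_sup,
        IntermediateField.adjoin_map, Set.image_singleton, hmap]
      rfl

theorem IsRepeatedRadicalExtension.sup_adjoin {K : IntermediateField F E}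
    (hK : IsRepeatedRadicalExtension K) {n : ℕ} (hn : 0 < n) {S : Set E} (hS : S.Finite)
    (h : ∀ x ∈ S, x ^ n ∈ K) :
    IsRepeatedRadicalExtension (K ⊔ IntermediateField.adjoin F S) := by
  induction S, hS using Set.Finite.induction_on with
  | empty => simpa using hK
  | @insert a S _ _ ih =>
    refine (ih fun x hx ↦ h x (Set.mem_insert_of_mem _ hx)).tail ?_
    refine isRadicalExtension_iff_sup.2
      ⟨a, n, hn, (le_sup_left : K ≤ _) (h a (Set.mem_insert _ _)), ?_⟩
    rw [Set.insert_eq, Set.union_comm, IntermediateField.adjoin_union, sup_assoc]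

theorem IsRepeatedRadicalExtension.le_solvableByRad {L : IntermediateField F E}
    (h : IsRepeatedRadicalExtension L) : L ≤ solvableByRad F E := by
  induction h with
  | refl => exact bot_le
  | tail _ hKM ih =>
    obtain ⟨α, n, hn, hα, rfl⟩ := isRadicalExtension_iff_sup.1 hKM
    refine sup_le ih (IntermediateField.adjoin_le_iff.2 ?_)
    rintro _ rfl
    exact solvableByRad.rad_mem hn.ne' (ih hα)

/-- If `x` is fixed by `H` and moved by `s ∈ K`, then `x - s x` is fixed by `H` and changes sign
under `K \ H`, so it is a square root generating the upper field. -/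
theorem isRadicalExtension_fixedField_of_card_eq_two_mul [FiniteDimensional F E] [IsGalois F E]
    [NeZero (2 : E)] {H K : Subgroup Gal(E/F)} (hHK : H ≤ K)
    (hcard : Nat.card K = 2 * Nat.card H) :
    IsRadicalExtension (IntermediateField.fixedField K) (IntermediateField.fixedField H) := by
  have hidx : H.relIndex K = 2 := by
    have h1 := Subgroup.card_mul_index (H.subgroupOf K)
    rw [Nat.card_congr (Subgroup.subgroupOfEquivOfLe hHK).toEquiv, hcard, mul_comm 2] at h1
    exact Nat.eq_of_mul_eq_mul_left Nat.card_pos h1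
  have hlt : ¬ IntermediateField.fixedField H ≤ IntermediateField.fixedField K := fun h ↦ by
    have := (IntermediateField.le_iff_le K _).1 h
    rw [IntermediateField.fixingSubgroup_fixedField] at this
    have := Subgroup.relIndex_eq_one.2 this
    omega
  obtain ⟨x, hxH, hxK⟩ := SetLike.not_le_iff_exists.1 hlt
  simp only [IntermediateField.mem_fixedField_iff] at hxH hxK
  push Not at hxK
  obtain ⟨s, hsK, hsx⟩ := hxK
  have hsH : s ∉ H := fun h ↦ hsx (hxH s h)
  have hmul : ∀ g ∈ K, g ∉ H → s⁻¹ * g ∈ H := fun g hg hgH ↦ by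
    have := Subgroup.mul_mem_iff_of_index_two (H := H.subgroupOf K) hidx
      (a := ⟨s, hsK⟩⁻¹) (b := ⟨g, hg⟩)
    simp only [Subgroup.mem_subgroupOf, Subgroup.coe_mul, inv_mem_iff] at this
    tauto
  have hact : ∀ g ∈ K, g ∉ H → g x = s x := fun g hg hgH ↦ by
    have := hxH _ (hmul g hg hgH)
    rw [AlgEquiv.mul_apply] at this
    calc g x = s (s⁻¹ (g x)) := by rw [← AlgEquiv.mul_apply s, mul_inv_cancel, AlgEquiv.one_apply]
      _ = s x := by rw [this]
  have hss : s (s x) = x := by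
    have : s * s ∈ H := by
      by_contra hc
      exact hsH (by simpa using hmul _ (mul_mem hsK hsK) hc)
    exact hxH _ this
  have hHs : ∀ g ∈ H, g (s x) = s x := fun g hg ↦ by
    have hgs : g * s ∉ H := fun hc ↦ hsH ((Subgroup.mul_mem_cancel_left H hg).1 hc)
    simpa using hact _ (mul_mem (hHK hg) hsK) hgs
  set y := x - s x with hy
  have hy0 : y ≠ 0 := sub_ne_zero.2 fun h ↦ hsx h.symm
  have hyK : ∀ g ∈ K, g ∉ H → g y = -y := fun g hg hgH ↦ by
    have h1 : g (s x) = x := by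
      have h2 : g * s ∈ H := by
        by_contra hc
        have := hmul _ (mul_mem hg hsK) hc
        have h3 := Subgroup.mul_mem_iff_of_index_two (H := H.subgroupOf K) hidx
          (a := ⟨g, hg⟩) (b := ⟨s, hsK⟩)
        simp only [Subgroup.mem_subgroupOf, Subgroup.coe_mul] at h3
        tauto
      exact hxH _ h2
    rw [hy, map_sub, hact g hg hgH, h1]
    ring
  have hyH : ∀ g ∈ H, g y = y := fun g hg ↦ by rw [hy, map_sub, hxH g hg, hHs g hg]
  refine isRadicalExtension_iff_sup.2 ⟨y, 2, two_pos, ?_, ?_⟩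
  · rw [IntermediateField.mem_fixedField_iff]
    intro g hg
    by_cases hgH : g ∈ H
    · rw [map_pow, hyH g hgH]
    · rw [map_pow, hyK g hg hgH, neg_sq]
  · rw [← IsGalois.fixedField_fixingSubgroup (_ ⊔ _)]
    congr 1
    rw [IntermediateField.fixingSubgroup_sup, IntermediateField.fixingSubgroup_fixedField]
    ext g
    rw [Subgroup.mem_inf, IntermediateField.mem_fixingSubgroup_iff]
    constructor
    · intro hg
      refine ⟨hHK hg, fun z hz ↦ ?_⟩
      have : IntermediateField.adjoin F {y} ≤ IntermediateField.fixedField H := by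
        rw [IntermediateField.adjoin_simple_le_iff]
        exact (IntermediateField.mem_fixedField_iff _ _).2 hyH
      exact (IntermediateField.mem_fixedField_iff _ _).1 (this hz) g hg
    · rintro ⟨hgK, hg⟩
      by_contra hgH
      have h1 := hg y (IntermediateField.mem_adjoin_simple_self F y)
      rw [hyK g hgK hgH, neg_eq_iff_add_eq_zero, ← two_mul] at h1
      exact (mul_ne_zero two_ne_zero hy0) h1

theorem isRepeatedRadicalExtension_top_of_isPGroup_two [FiniteDimensional F E] [IsGalois F E]
    [NeZero (2 : E)] (h : IsPGroup 2 Gal(E/F)) :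
    IsRepeatedRadicalExtension (⊤ : IntermediateField F E) := by
  obtain ⟨m, hm⟩ := IsPGroup.iff_card.1 h
  have key : ∀ d ≤ m, ∀ H : Subgroup Gal(E/F), Nat.card H = 2 ^ (m - d) →
      IsRepeatedRadicalExtension (IntermediateField.fixedField H) := by
    -- Descend from the whole group, enlarging a subgroup of order `2 ^ (m - (d + 1))` to one of
    -- twice the order by Sylow.
    intro d
    induction d with
    | zero =>
      intro _ H hH
      have : H = ⊤ := Subgroup.eq_top_of_card_eq H (by rw [hH, hm, Nat.sub_zero])
      rw [this, IsGalois.fixedField_top]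
      exact Relation.ReflTransGen.refl
    | succ d ih =>
      intro hd H hH
      have : m - d = m - (d + 1) + 1 := by omega
      obtain ⟨K, hK, hHK⟩ := Sylow.exists_subgroup_card_pow_succ (p := 2) (n := m - (d + 1))
        (by rw [hm]; exact pow_dvd_pow 2 (by omega)) hH
      rw [← this] at hK
      refine (ih (by omega) K hK).tail
        (isRadicalExtension_fixedField_of_card_eq_two_mul hHK ?_)
      rw [hK, hH, this, pow_succ, mul_comm]
  have := key m le_rfl ⊥ (by simp)
  rwa [IntermediateField.fixedField_bot] at this

end RadicalExtensions

open scoped commutatorElement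

/-! ### Solvable groups of prime degree -/

section SolvablePrimeDegree

theorem Group.IsSolvable.exists_normal_isMulCommutative_ne_bot (G : Type*) [Group G]
    [Group.IsSolvable G] [Nontrivial G] :
    ∃ A : Subgroup G, A.Normal ∧ A ≠ ⊥ ∧ ∀ a ∈ A, ∀ b ∈ A, a * b = b * a := by
  classical
  have hex : ∃ n, derivedSeries G n = ⊥ := Group.IsSolvable.solvable
  have h0 : Nat.find hex ≠ 0 := fun h ↦ by
    have := Nat.find_spec hex
    rw [h, derivedSeries_zero] at this
    exact top_ne_bot this
  obtain ⟨n, hn⟩ := Nat.exists_eq_succ_of_ne_zero h0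
  refine ⟨derivedSeries G n, inferInstance, Nat.find_min hex (by omega), fun a ha b hb ↦ ?_⟩
  have h1 := Nat.find_spec hex
  rw [hn, derivedSeries_succ] at h1
  have : ⁅a, b⁆ ∈ (⊥ : Subgroup G) := h1 ▸ Subgroup.commutator_mem_commutator ha hb
  exact commutatorElement_eq_one_iff_mul_comm.1 (Subgroup.mem_bot.1 this)

/-- Prime degree forces primitivity, so a nontrivial abelian normal subgroup is transitive. Being
abelian and faithful it is regular, hence cyclic of order `p`; `σ` generates it. -/
theorem MulAction.exists_normalized_transitive_of_isSolvable_of_prime_card {G X : Type*} [Group G]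
    [MulAction G X] [FaithfulSMul G X] [MulAction.IsPretransitive G X] [Group.IsSolvable G]
    {p : ℕ} (hp : p.Prime) (hX : Nat.card X = p) :
    ∃ σ : G, σ ^ p = 1 ∧ (∀ x y : X, ∃ i : ℕ, σ ^ i • x = y) ∧
      ∀ g : G, ∃ a : ℕ, g * σ * g⁻¹ = σ ^ a := by
  have : Finite X := Nat.finite_of_card_ne_zero (hX ▸ hp.ne_zero)
  have : Nontrivial X := Finite.one_lt_card_iff_nontrivial.1 (hX ▸ hp.one_lt)
  have : Nontrivial G := by
    obtain ⟨x, y, hxy⟩ := exists_pair_ne X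
    obtain ⟨g, rfl⟩ := MulAction.exists_smul_eq G x y
    exact ⟨g, 1, fun h ↦ hxy (by rw [h, one_smul])⟩
  have : MulAction.IsPreprimitive G X := MulAction.IsPreprimitive.of_prime_card (hX ▸ hp)
  obtain ⟨A, hAn, hA, hcomm⟩ := Group.IsSolvable.exists_normal_isMulCommutative_ne_bot G
  have hfix : MulAction.fixedPoints A X ≠ Set.univ := fun h ↦ hA <| by
    rw [Subgroup.eq_bot_iff_forall]
    intro a ha
    refine FaithfulSMul.eq_of_smul_eq_smul (α := X) fun x ↦ ?_
    have hx : x ∈ MulAction.fixedPoints A X := h ▸ Set.mem_univ x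
    rw [one_smul]
    exact hx ⟨a, ha⟩
  have htr : MulAction.IsPretransitive A X :=
    MulAction.IsQuasiPreprimitive.isPretransitive_of_normal hfix
  obtain ⟨x₀⟩ : Nonempty X := inferInstance
  have hbij : Function.Bijective fun a : A ↦ a • x₀ := by
    refine ⟨fun a b hab ↦ ?_, fun y ↦ MulAction.exists_smul_eq A x₀ y⟩
    refine Subtype.ext (FaithfulSMul.eq_of_smul_eq_smul (α := X) fun y ↦ ?_)
    obtain ⟨c, rfl⟩ := MulAction.exists_smul_eq A x₀ y
    have hab' : (a : G) • x₀ = (b : G) • x₀ := hab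
    change (a : G) • (c : G) • x₀ = (b : G) • (c : G) • x₀
    rw [smul_smul, smul_smul, hcomm a a.2 c c.2, hcomm b b.2 c c.2, mul_smul, mul_smul, hab']
  have hcard : Nat.card A = p := (Nat.card_eq_of_bijective _ hbij).trans hX
  have : Fact p.Prime := ⟨hp⟩
  have : Finite A := Nat.finite_of_card_ne_zero (hcard ▸ hp.ne_zero)
  obtain ⟨⟨σ, hσA⟩, hσ⟩ := (isCyclic_of_prime_card hcard).exists_generator
  have hgen : ∀ a ∈ A, ∃ i : ℕ, a = σ ^ i := fun a ha ↦ by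
    obtain ⟨i, hi⟩ := (mem_powers_iff_mem_zpowers).2 (hσ ⟨a, ha⟩)
    exact ⟨i, (congrArg Subtype.val hi).symm⟩
  refine ⟨σ, ?_, fun x y ↦ ?_, fun g ↦ hgen _ (hAn.conj_mem σ hσA g)⟩
  · have := pow_card_eq_one' (x := (⟨σ, hσA⟩ : A))
    rw [hcard] at this
    exact congrArg Subtype.val this
  · obtain ⟨a, ha⟩ := MulAction.exists_smul_eq A x y
    obtain ⟨i, hi⟩ := hgen a a.2
    exact ⟨i, by rw [← hi]; exact ha⟩

theorem Group.isSolvable_perm_of_card_eq_three {X : Type*} (hX : Nat.card X = 3) :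
    Group.IsSolvable (Equiv.Perm X) := by
  classical
  have : Finite X := Nat.finite_of_card_ne_zero (by omega)
  have := Fintype.ofFinite X
  have : Nontrivial X := Finite.one_lt_card_iff_nontrivial.1 (by omega)
  have hA : Nat.card (alternatingGroup X) = 3 := by
    have := two_mul_card_alternatingGroup (α := X)
    rw [Fintype.card_perm, ← Nat.card_eq_fintype_card, ← Nat.card_eq_fintype_card, hX] at this
    rw [show Nat.factorial 3 = 6 from rfl] at this
    omega
  have : Fact (Nat.Prime 3) := ⟨Nat.prime_three⟩
  have hcyc := isCyclic_of_prime_card hA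
  have : Group.IsSolvable (alternatingGroup X) :=
    Group.isSolvable_of_comm fun a b ↦ by
      let _ := hcyc.commGroup
      exact mul_comm a b
  refine Group.isSolvable_of_ker_le_range (alternatingGroup X).subtype
    (Equiv.Perm.sign (α := X)) ?_
  rw [Subgroup.range_subtype]
  exact le_rfl

end SolvablePrimeDegree

/-! ### Lagrange resolvents -/

section LagrangeResolvent

variable {p : ℕ} [Fact p.Prime]

/-- The Lagrange resolvents of a family indexed by `ZMod p`. -/
def lagrangeResolvent {K : Type*} [Field K] (ψ : AddChar (ZMod p) K) (x : ZMod p → K)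
    (j : ZMod p) : K :=
  ∑ i, ψ (j * i) * x i

variable {F K : Type*} [Field F] [Field K] [Algebra F K]
  {ψ : AddChar (ZMod p) K} {x : ZMod p → K}

theorem sum_lagrangeResolvent (hψ : ψ.IsPrimitive) :
    ∑ j, lagrangeResolvent ψ x j = p * x 0 := by
  simp only [lagrangeResolvent]
  rw [Finset.sum_comm]
  simp only [← Finset.sum_mul, AddChar.sum_mulShift _ hψ, ZMod.card]
  simp

/-- Reindexing the sum leaves a value of `ψ` as a factor, and the `p`-th power kills it. -/
theorem map_lagrangeResolvent_pow {h : Gal(K/F)} {k a b : ZMod p} (ha : a ≠ 0)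
    (hψ : ∀ i, h (ψ i) = ψ (k * i)) (hx : ∀ i, h (x i) = x (a * i + b)) (j : ZMod p) :
    h (lagrangeResolvent ψ x j ^ p) = lagrangeResolvent ψ x (k * a⁻¹ * j) ^ p := by
  have h1 : h (lagrangeResolvent ψ x j) =
      ψ (-(k * a⁻¹ * j * b)) * lagrangeResolvent ψ x (k * a⁻¹ * j) := by
    simp only [lagrangeResolvent, map_sum, map_mul, hψ, hx, Finset.mul_sum, ← mul_assoc,
      ← AddChar.map_add_eq_mul]
    refine Fintype.sum_equiv ((Equiv.mulLeft₀ a ha).trans (Equiv.addRight b)) _ _ fun i ↦ ?_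
    simp only [Equiv.trans_apply, Equiv.mulLeft₀_apply, Equiv.coe_addRight]
    congr 2
    field_simp
    ring
  rw [map_pow, h1, mul_pow, ← AddChar.map_nsmul_eq_pow]
  simp

theorem map_lagrangeResolvent_of_neg {h : Gal(K/F)} (hψ : ∀ i, h (ψ i) = ψ (-i))
    (hx : ∀ i, h (x i) = x (-i)) (j : ZMod p) :
    h (lagrangeResolvent ψ x j) = lagrangeResolvent ψ x j := by
  simp only [lagrangeResolvent, map_sum, map_mul, hψ, hx]
  refine Fintype.sum_equiv (Equiv.neg _) _ _ fun i ↦ ?_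
  simp

theorem mem_adjoin_lagrangeResolvent [CharZero K] (hψ : ψ.IsPrimitive) :
    x 0 ∈ IntermediateField.adjoin F (Set.range (lagrangeResolvent ψ x)) := by
  have hp : (p : K) ≠ 0 := Nat.cast_ne_zero.2 (Fact.out : p.Prime).ne_zero
  rw [← mul_div_cancel_left₀ (x 0) hp, ← sum_lagrangeResolvent hψ]
  exact div_mem (sum_mem fun j _ ↦ IntermediateField.subset_adjoin F _ ⟨j, rfl⟩) (natCast_mem _ _)

variable [IsGalois F K]

/-- Fermat's little theorem: `u ^ (p - 1) = 1`, so `h ^ (2 ^ m)` fixes all generators. -/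
theorem isPGroup_gal_adjoin_of_map_eq_mul {m : ℕ} (hm : p - 1 = 2 ^ m) {θ : ZMod p → K}
    (hθ : ∀ h : Gal(K/F), ∃ u : ZMod p, u ≠ 0 ∧ ∀ j, h (θ j) = θ (u * j))
    [Normal F (IntermediateField.adjoin F (Set.range θ))] :
    IsPGroup 2 Gal(IntermediateField.adjoin F (Set.range θ)/F) := by
  intro g
  obtain ⟨h, rfl⟩ := AlgEquiv.restrictNormalHom_surjective (F := F)
    (K₁ := IntermediateField.adjoin F (Set.range θ)) K g
  obtain ⟨u, hu0, hu⟩ := hθ h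
  refine ⟨m, ?_⟩
  rw [← map_pow, ← hm]
  have hpow : ∀ (n : ℕ) (j : ZMod p), (h ^ n) (θ j) = θ (u ^ n * j) := by
    intro n
    induction n with
    | zero => simp
    | succ n ih => intro j; rw [pow_succ, AlgEquiv.mul_apply, hu, ih, pow_succ, mul_assoc]
  have hle : IntermediateField.adjoin F (Set.range θ) ≤
      IntermediateField.fixedField (Subgroup.zpowers (h ^ (p - 1))) := by
    rw [IntermediateField.adjoin_le_iff]
    rintro _ ⟨j, rfl⟩
    have hfix : h ^ (p - 1) ∈ MulAction.stabilizer Gal(K/F) (θ j) := by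
      rw [MulAction.mem_stabilizer_iff, AlgEquiv.smul_def, hpow, ZMod.pow_card_sub_one_eq_one hu0,
        one_mul]
    exact (IntermediateField.mem_fixedField_iff _ _).2 fun g hg ↦
      (Subgroup.zpowers_le.2 hfix) hg
  ext ⟨y, hy⟩
  rw [AlgEquiv.restrictNormalHom_apply]
  exact (IntermediateField.mem_fixedField_iff _ _).1 (hle hy) _ (Subgroup.mem_zpowers _)

theorem isRepeatedRadicalExtension_adjoin_lagrangeResolvent [CharZero K] {m : ℕ} (hm : p - 1 = 2 ^ m)
    (hψ : ∀ h : Gal(K/F), ∃ k : ZMod p, k ≠ 0 ∧ ∀ i, h (ψ i) = ψ (k * i))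
    (hx : ∀ h : Gal(K/F), ∃ a b : ZMod p, a ≠ 0 ∧ ∀ i, h (x i) = x (a * i + b)) :
    IsRepeatedRadicalExtension
      (IntermediateField.adjoin F (Set.range (lagrangeResolvent ψ x))) := by
  set θ : ZMod p → K := fun j ↦ lagrangeResolvent ψ x j ^ p with hθdef
  have hθ : ∀ h : Gal(K/F), ∃ u : ZMod p, u ≠ 0 ∧ ∀ j, h (θ j) = θ (u * j) := fun h ↦ by
    obtain ⟨k, hk, hψk⟩ := hψ h
    obtain ⟨a, b, ha, hxa⟩ := hx h
    exact ⟨k * a⁻¹, mul_ne_zero hk (inv_ne_zero ha), map_lagrangeResolvent_pow ha hψk hxa⟩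
  set T := IntermediateField.adjoin F (Set.range θ) with hT
  have hnormal : Normal F T := by
    rw [IntermediateField.normal_iff_forall_map_le']
    intro h
    rw [hT, IntermediateField.adjoin_map, IntermediateField.adjoin_le_iff]
    rintro _ ⟨_, ⟨j, rfl⟩, rfl⟩
    obtain ⟨u, -, hu⟩ := hθ h
    exact IntermediateField.subset_adjoin F _ ⟨u * j, (hu j).symm⟩
  have hfin : FiniteDimensional F T :=
    IntermediateField.finiteDimensional_adjoin fun y _ ↦ Algebra.IsIntegral.isIntegral y
  have hgal : IsGalois F T := {}
  have hTrad : IsRepeatedRadicalExtension T := by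
    have := (isRepeatedRadicalExtension_top_of_isPGroup_two
      (isPGroup_gal_adjoin_of_map_eq_mul hm hθ)).map T.val
    rwa [← AlgHom.fieldRange_eq_map, IntermediateField.fieldRange_val] at this
  have hp : 0 < p := (Fact.out : p.Prime).pos
  have hmem : ∀ y ∈ Set.range (lagrangeResolvent ψ x), y ^ p ∈ T := by
    rintro _ ⟨j, rfl⟩
    exact IntermediateField.subset_adjoin F (Set.range θ) (Set.mem_range_self j)
  have := hTrad.sup_adjoin hp (Set.finite_range (lagrangeResolvent ψ x)) hmem
  rwa [sup_eq_right.2] at this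
  rw [hT, IntermediateField.adjoin_le_iff]
  rintro _ ⟨j, rfl⟩
  exact pow_mem (IntermediateField.subset_adjoin F _ (Set.mem_range_self j)) p

end LagrangeResolvent

/-! ### Affine action on the roots -/

section Roots

variable {p : ℕ} [Fact p.Prime] {F K : Type*} [Field F] [Field K] [Algebra F K]

theorem Polynomial.natCard_rootSet_eq_natDegree [CharZero F] [IsAlgClosed K] {f : F[X]}
    (hf : Irreducible f) : Nat.card (f.rootSet K) = f.natDegree := by
  rw [Nat.card_eq_fintype_card]
  exact card_rootSet_eq_natDegree hf.separable (IsAlgClosed.splits _)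

/-- Label the roots by `i ↦ σ ^ i • α`; normalizing `⟨σ⟩` means acting affinely on labels. -/
theorem exists_equiv_zmod_rootSet_affine [CharZero F] [IsAlgClosed K] {f : F[X]}
    (hf : Irreducible f) (hdeg : f.natDegree = p) (hsol : Group.IsSolvable f.Gal) (α : f.rootSet K) :
    ∃ x : ZMod p ≃ f.rootSet K, x 0 = α ∧
      ∀ h : Gal(K/F), ∃ a b : ZMod p, a ≠ 0 ∧ ∀ i, h (x i) = x (a * i + b) := by
  have : Fact ((f.map (algebraMap F K)).Splits) := ⟨IsAlgClosed.splits _⟩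
  have hcard : Nat.card (f.rootSet K) = p := (natCard_rootSet_eq_natDegree hf).trans hdeg
  have : MulAction.IsPretransitive f.Gal (f.rootSet K) := Gal.galAction_isPretransitive f K hf
  have : FaithfulSMul f.Gal (f.rootSet K) :=
    ⟨fun {g₁ g₂} h ↦ Gal.galActionHom_injective f K (Equiv.ext h)⟩
  obtain ⟨σ, hσp, htr, hconj⟩ :=
    MulAction.exists_normalized_transitive_of_isSolvable_of_prime_card (G := f.Gal)
      (Fact.out : p.Prime) hcard
  have hpow : ∀ n : ℕ, σ ^ (n : ZMod p).val = σ ^ n := fun n ↦ by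
    rw [ZMod.val_natCast, ← pow_eq_pow_mod n hσp]
  set y : ZMod p → f.rootSet K := fun i ↦ σ ^ i.val • α with hy
  have hynat : ∀ n : ℕ, y n = σ ^ n • α := fun n ↦ by rw [hy]; simp only [hpow]
  have hsurj : Function.Surjective y := fun z ↦ by
    obtain ⟨i, hi⟩ := htr α z
    exact ⟨i, (hynat i).trans hi⟩
  have hbij : Function.Bijective y :=
    (Nat.bijective_iff_surjective_and_card y).2 ⟨hsurj, by rw [hcard, Nat.card_zmod]⟩
  refine ⟨Equiv.ofBijective y hbij, by simp [hy], fun h ↦ ?_⟩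
  simp only [Equiv.ofBijective_apply]
  set g := Gal.restrict f K h
  have hg : ∀ z : f.rootSet K, h z = (g • z : f.rootSet K) :=
    fun z ↦ (Gal.restrict_smul h z).symm
  obtain ⟨a, ha⟩ := hconj g
  obtain ⟨b, hb⟩ := htr α (g • α)
  have haff : ∀ i, h (y i) = y ((a : ZMod p) * i + (b : ZMod p)) := fun i ↦ by
    obtain ⟨n, rfl⟩ := ZMod.natCast_zmod_surjective i
    rw [hg]
    congr 1
    rw [← Nat.cast_mul, ← Nat.cast_add, hynat, hynat, pow_add, mul_smul, hb, pow_mul, ← ha,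
      conj_pow, smul_smul, smul_smul, inv_mul_cancel_right]
  refine ⟨a, b, fun ha0 ↦ ?_, haff⟩
  have h01 : h (y 0) = h (y 1) := by rw [haff, haff, ha0, zero_mul, zero_mul]
  exact zero_ne_one (hbij.1 (Subtype.ext (h.injective h01)))

theorem exists_map_addChar_eq {ζ : K} (hζ : IsPrimitiveRoot ζ p) (h : Gal(K/F)) :
    ∃ k : ZMod p, k ≠ 0 ∧
      ∀ i, h (AddChar.zmodChar p hζ.pow_eq_one i) = AddChar.zmodChar p hζ.pow_eq_one (k * i) := by
  obtain ⟨k, -, hk⟩ := hζ.eq_pow_of_pow_eq_one (ξ := h ζ) (by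
    rw [← map_pow, hζ.pow_eq_one, map_one])
  refine ⟨k, fun hk0 ↦ ?_, fun i ↦ ?_⟩
  · rw [ZMod.natCast_eq_zero_iff] at hk0
    obtain ⟨d, rfl⟩ := hk0
    rw [pow_mul, hζ.pow_eq_one, one_pow, eq_comm, EmbeddingLike.map_eq_one_iff] at hk
    exact hζ.ne_one (Fact.out : p.Prime).one_lt hk
  · obtain ⟨n, rfl⟩ := ZMod.natCast_zmod_surjective i
    rw [← Nat.cast_mul, AddChar.zmodChar_apply', AddChar.zmodChar_apply', map_pow, ← hk, pow_mul]

theorem exists_root_fixed_of_mul_self_eq_one [CharZero F] [IsAlgClosed K] {f : F[X]}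
    (hf : Irreducible f) (hdeg : ¬ 2 ∣ f.natDegree) {c : Gal(K/F)} (hc : c * c = 1) :
    ∃ α : K, aeval α f = 0 ∧ c α = α := by
  have hcc : ∀ z, c (c z) = z := fun z ↦ by
    rw [← AlgEquiv.mul_apply, hc, AlgEquiv.one_apply]
  have hcroot : ∀ z : f.rootSet K, c z ∈ f.rootSet K := fun z ↦ by
    rw [mem_rootSet_of_ne hf.ne_zero, aeval_algHom_apply, aeval_eq_zero_of_mem_rootSet z.2,
      map_zero]
  let s : Equiv.Perm (f.rootSet K) :=
    Function.Involutive.toPerm (fun z ↦ ⟨c z, hcroot z⟩) fun z ↦ Subtype.ext (hcc z)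
  obtain ⟨z, hz⟩ := Equiv.Perm.exists_fixed_point_of_prime (p := 2) (n := 1) (σ := s)
    (by rwa [← Nat.card_eq_fintype_card, natCard_rootSet_eq_natDegree hf])
    (Equiv.ext fun z ↦ Subtype.ext (hcc z))
  exact ⟨z, aeval_eq_zero_of_mem_rootSet z.2, congrArg Subtype.val hz⟩

theorem exists_isRepeatedRadicalExtension_le_fixed [CharZero F] [IsAlgClosed K] [IsGalois F K]
    {f : F[X]} (hf : Irreducible f) (hdeg : f.natDegree = p) (hsol : Group.IsSolvable f.Gal) {m : ℕ}
    (hm : p - 1 = 2 ^ m) {c : Gal(K/F)} (hc : c * c = 1) (hcζ : ∀ ζ : K, ζ ^ p = 1 → c ζ = ζ⁻¹)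
    {α : K} (hα : aeval α f = 0) (hcα : c α = α) {β : K} (hβ : aeval β f = 0) (hcβ : c β ≠ β) :
    ∃ L : IntermediateField F K, IsRepeatedRadicalExtension L ∧ α ∈ L ∧ ∀ z ∈ L, c z = z := by
  have : CharZero K := charZero_of_injective_algebraMap (algebraMap F K).injective
  have : NeZero (p : K) := ⟨Nat.cast_ne_zero.2 (Fact.out : p.Prime).ne_zero⟩
  obtain ⟨ζ, hζ⟩ := HasEnoughRootsOfUnity.exists_primitiveRoot K p
  set ψ := AddChar.zmodChar p hζ.pow_eq_one with hψdef
  have hψ : ψ.IsPrimitive := AddChar.zmodChar_primitive_of_primitive_root p hζ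
  obtain ⟨x, hx0, hx⟩ := exists_equiv_zmod_rootSet_affine (K := K) hf hdeg hsol
    ⟨α, (mem_rootSet_of_ne hf.ne_zero).2 hα⟩
  set y : ZMod p → K := fun i ↦ x i with hy
  have hyinj : Function.Injective y := Subtype.val_injective.comp x.injective
  have hy0 : y 0 = α := by rw [hy]; simp only [hx0]
  have hcψ : ∀ i, c (ψ i) = ψ (-i) := fun i ↦ by
    rw [AddChar.map_neg_eq_inv]
    refine hcζ _ ?_
    rw [← AddChar.map_nsmul_eq_pow]
    simp
  have hcy : ∀ i, c (y i) = y (-i) := by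
    obtain ⟨a, b, -, hab⟩ := hx c
    change ∀ i, c (y i) = y (a * i + b) at hab
    have hb : b = 0 := by
      have := hab 0
      rw [hy0, hcα, ← hy0, mul_zero, zero_add] at this
      exact (hyinj this).symm
    simp only [hb, add_zero] at hab
    have ha : a * a = 1 := by
      have h1 : c (c (y 1)) = y 1 := by rw [← AlgEquiv.mul_apply, hc, AlgEquiv.one_apply]
      rw [hab, hab, mul_one] at h1
      exact hyinj h1
    -- The case `a = 1` would fix every root, including `β`.
    rcases mul_self_eq_one_iff.1 ha with rfl | rfl
    · obtain ⟨i, hi⟩ := x.surjective ⟨β, (mem_rootSet_of_ne hf.ne_zero).2 hβ⟩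
      have hi' : y i = β := by rw [hy]; simp only [hi]
      exact absurd (by rw [← hi', hab, one_mul]) hcβ
    · simpa only [neg_one_mul] using hab
  refine ⟨_, isRepeatedRadicalExtension_adjoin_lagrangeResolvent (F := F) (ψ := ψ) (x := y) hm
    (exists_map_addChar_eq hζ) hx, hy0 ▸ mem_adjoin_lagrangeResolvent hψ, fun z hz ↦ ?_⟩
  have hle : IntermediateField.adjoin F (Set.range (lagrangeResolvent ψ y)) ≤
      IntermediateField.fixedField (Subgroup.zpowers c) := by
    rw [IntermediateField.adjoin_le_iff]
    rintro _ ⟨j, rfl⟩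
    have hfix : c ∈ MulAction.stabilizer Gal(K/F) (lagrangeResolvent ψ y j) :=
      map_lagrangeResolvent_of_neg hcψ hcy j
    exact (IntermediateField.mem_fixedField_iff _ _).2 fun g hg ↦
      (Subgroup.zpowers_le.2 hfix) hg
  exact (IntermediateField.mem_fixedField_iff _ _).1 (hle hz) c (Subgroup.mem_zpowers c)

end Roots

/-! ### Complex conjugation and descent to the reals -/

section Real

theorem IsSolvableByRadicals.isSolvable_gal {F : Type*} [Field F] {f : F[X]} (hf : Irreducible f)
    (h : IsSolvableByRadicals f) : Group.IsSolvable f.Gal := by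
  obtain ⟨R, hR, hle⟩ := h
  obtain ⟨α, hα⟩ := IsAlgClosed.exists_aeval_eq_zero (AlgebraicClosure F) f hf.degree_pos.ne'
  exact isSolvable_gal_of_irreducible (hR.le_solvableByRad (hle
    (IntermediateField.subset_adjoin F _ ((mem_rootSet_of_ne hf.ne_zero).2 hα)))) hf hα

theorem isSolvable_gal_of_natDegree_eq_three {F : Type*} [Field F] [CharZero F] {f : F[X]}
    (hf : Irreducible f) (hdeg : f.natDegree = 3) : Group.IsSolvable f.Gal := by
  have : Fact ((f.map (algebraMap F (AlgebraicClosure F))).Splits) := ⟨IsAlgClosed.splits _⟩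
  have := Group.isSolvable_perm_of_card_eq_three
    ((natCard_rootSet_eq_natDegree (K := AlgebraicClosure F) hf).trans hdeg)
  exact Group.isSolvable_of_isSolvable_injective
    (Gal.galActionHom_injective f (AlgebraicClosure F))

theorem IsFermatPrime.exists_sub_one_eq_two_pow {p : ℕ} (hp : IsFermatPrime p) :
    ∃ m : ℕ, p - 1 = 2 ^ m ∧ ¬ 2 ∣ p := by
  obtain ⟨-, k, rfl⟩ := hp
  refine ⟨2 ^ k, rfl, ?_⟩
  rw [Nat.two_dvd_ne_zero, Nat.add_mod, Nat.pow_mod]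
  simp

theorem exists_real_root_mem_isRepeatedRadicalExtension (Q : Subfield ℝ) {f : Q[X]}
    (hf : Irreducible f) {p : ℕ} (hp : IsFermatPrime p) (hdeg : f.natDegree = p)
    (hsol : Group.IsSolvable f.Gal) (hns : ¬ (f.map (algebraMap Q ℝ)).Splits) :
    ∃ α : ℝ, aeval α f = 0 ∧
      ∃ L : IntermediateField Q ℝ, IsRepeatedRadicalExtension L ∧ α ∈ L := by
  have : Fact p.Prime := ⟨hp.1⟩
  obtain ⟨m, hm, hodd⟩ := hp.exists_sub_one_eq_two_pow
  let Ω := algebraicClosure Q ℂ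
  have : IsAlgClosed Ω := IsAlgClosure.isAlgClosed Q
  have : IsGalois Q Ω := IsAlgClosure.isGalois Q Ω
  let conj : ℂ ≃ₐ[Q] ℂ := Complex.conjAe.restrictScalars Q
  let c : Gal(Ω/Q) := conj.restrictNormal Ω
  have hcoe : ∀ z : Ω, (c z : ℂ) = (starRingEnd ℂ) z := fun z ↦
    AlgEquiv.restrictNormal_commutes conj Ω z
  have hc : c * c = 1 := by
    ext z
    rw [AlgEquiv.mul_apply, hcoe, hcoe, Complex.conj_conj, AlgEquiv.one_apply]
  have hcζ : ∀ ζ : Ω, ζ ^ p = 1 → c ζ = ζ⁻¹ := fun ζ hζ ↦ by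
    have h1 : (ζ : ℂ) ^ p = 1 := congrArg Subtype.val hζ
    apply Subtype.ext
    rw [hcoe]
    exact (Complex.inv_eq_conj (Complex.norm_eq_one_of_pow_eq_one h1 hp.1.ne_zero)).symm
  let φ : ℝ →ₐ[Q] ℂ := IsScalarTower.toAlgHom Q ℝ ℂ
  have hreal : ∀ z : Ω, c z = z → ∃ r : ℝ, φ r = z := fun z hz ↦ by
    obtain ⟨r, hr⟩ := Complex.conj_eq_iff_real.1 ((hcoe z).symm.trans (congrArg Subtype.val hz))
    exact ⟨r, hr.symm⟩
  obtain ⟨α, hα, hcα⟩ := exists_root_fixed_of_mul_self_eq_one hf (hdeg ▸ hodd) hc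
  obtain ⟨β, hβ, hcβ⟩ : ∃ β : Ω, aeval β f = 0 ∧ c β ≠ β := by
    by_contra! hall
    -- If conjugation fixed every root, all complex roots would be real and `f` would split.
    refine hns (Splits.of_splits_map (algebraMap ℝ ℂ) (IsAlgClosed.splits _) fun z hz ↦ ?_)
    rw [map_map, ← IsScalarTower.algebraMap_eq, mem_roots (map_ne_zero hf.ne_zero), IsRoot.def,
      eval_map_algebraMap] at hz
    have hzΩ : z ∈ Ω := mem_algebraicClosure_iff.2 ⟨f, hf.ne_zero, hz⟩
    exact hreal ⟨z, hzΩ⟩ (hall ⟨z, hzΩ⟩ (Subtype.ext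
      ((aeval_algHom_apply Ω.val (⟨z, hzΩ⟩ : Ω) f).symm.trans hz)))
  obtain ⟨L, hL, hαL, hfix⟩ :=
    exists_isRepeatedRadicalExtension_le_fixed hf hdeg hsol hm hc hcζ hα hcα hβ hcβ
  obtain ⟨r, hr⟩ := hreal α hcα
  -- The tower is pushed from `Ω` to `ℂ`, then pulled back to `ℝ`, possible since conjugation fixes
  -- `L` pointwise.
  refine ⟨r, φ.injective ?_, (L.map Ω.val).comap φ, (hL.map Ω.val).comap φ ?_, α, hαL, hr.symm⟩
  · calc φ (aeval r f) = aeval (φ r) f := (aeval_algHom_apply φ r f).symm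
      _ = aeval (Ω.val α) f := by rw [hr]; rfl
      _ = φ 0 := by rw [aeval_algHom_apply Ω.val α f, hα, map_zero, map_zero]
  · rintro _ ⟨z, hz, rfl⟩
    exact hreal z (hfix z hz)

end Real

theorem theorem9p2 (Q : Subfield ℝ) (f : Q[X]) (hf : Irreducible f) :
    (∀ p : ℕ, IsFermatPrime p → f.natDegree = p → IsSolvableByRadicals f →
        ¬ (f.map (algebraMap Q ℝ)).Splits →
        ∃ α : ℝ, aeval α f = 0 ∧
          ∃ L : IntermediateField Q ℝ, IsRepeatedRadicalExtension L ∧ α ∈ L) ∧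
    (f.natDegree = 3 → ∀ α : ℝ, aeval α f = 0 → (∀ β : ℝ, aeval β f = 0 → β = α) →
        ∃ L : IntermediateField Q ℝ, IsRepeatedRadicalExtension L ∧ α ∈ L) := by
  refine ⟨fun p hp hdeg hsol hns ↦ exists_real_root_mem_isRepeatedRadicalExtension Q hf hp hdeg
    (hsol.isSolvable_gal hf) hns, fun hdeg α _ huniq ↦ ?_⟩
  have hns : ¬ (f.map (algebraMap Q ℝ)).Splits := fun hs ↦ by
    have h3 := card_rootSet_eq_natDegree hf.separable hs
    have : Fintype.card (f.rootSet ℝ) ≤ 1 := Fintype.card_le_one_iff.2 fun a b ↦ Subtype.ext <| by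
      rw [huniq a ((mem_rootSet_of_ne hf.ne_zero).1 a.2),
        huniq b ((mem_rootSet_of_ne hf.ne_zero).1 b.2)]
    omega
  obtain ⟨β, hβ, L, hL, hβL⟩ := exists_real_root_mem_isRepeatedRadicalExtension Q hf
    ⟨Nat.prime_three, 0, rfl⟩ hdeg (isSolvable_gal_of_natDegree_eq_three hf hdeg) hns
  exact ⟨L, hL, huniq β hβ ▸ hβL⟩
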